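/- Let $\mathbb N=\{0,1,2,\dots\}$, and for $k\ge 1$ let $\omega^{\downarrow k}$ (resp. $\omega^{\downarrow\le k}$) be the set of non-decreasing sequences of natural numbers of length $k$ (resp. of length at most $k$). On $\omega^{\downarrow\le k}$ let $s\sqsubset t$ mean that $s$ is a proper initial segment of $t$, and let $\prec$ be the following order: the empty sequence precedes every other one, and for non-empty sequences $(s_1,\dots,s_i)\prec(t_1,\dots,t_j)$ iff $s_i<t_j$, or $s_i=t_j$ and $(s_1,\dots,s_i)$ is lexicographically smaller than $(t_1,\dots,t_j)$ (a proper initial segment of a sequence being lexicographically smaller than it). Let $\mathcal E_k$ be the collection of all sets $\{\widehat X(u):u\in\omega^{\downarrow k}\}$, where $\widehat X:\omega^{\downarrow\le k}\to\omega^{\downarrow\le k}$ is a map preserving both $\prec$ and $\sqsubset$, and let $\mathcal{AR}^k$ be the family of all sets consisting of the $n$ $\prec$-least elements of some $X\in\mathcal E_k$, for some $n\ge 1$. For finite sets $E,F\subset\omega^{\downarrow k}$ write $E<F$ if $v\prec w$ for all $v\in E$, $w\in F$. Let $d$ be a positive integer and $0<\theta<1$. For finitely supported $x:\omega^{\downarrow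 k}\to\mathbb R$ and $E\subset\omega^{\downarrow k}$ let $Ex$ be the function that equals $x$ on $E$ and $0$ elsewhere; put $|x|_0=\max_v|x_v|$, $$|x|_{j+1}=\max\Bigl\{|x|_j,\ \theta\max\Bigl\{\sum_{i=1}^m|E_ix|_j:\ 1\le m\le d,\ E_1,\dots,E_m\in\mathcal{AR}^k,\ E_1<\dots<E_m\Bigr\}\Bigr\},$$ and $\|x\|=\sup_j|x|_j$. This is a norm on the space $c_{00}(\omega^{\downarrow k})$ of finitely supported functions; let $T_k(d,\theta)$ be the completion. **Theorem.** Assume $d\theta>1$, and let $k_1,k_2\ge 1$. 1. If $k_1\ne k_2$, then $T_{k_1}(d,\theta)$ and $T_{k_2}(d,\theta)$ are not isomorphic, i.e. there is no linear homeomorphism between them. 2. If $k_1>k_2$, then $T_{k_1}(d,\theta)$ does not embed into $T_{k_2}(d,\theta)$, i.e. there are no bounded linear map $\Phi:T_{k_1}(d,\theta)\to T_{k_2}(d,\theta)$ and $c>0$ with $\|\Phi x\|\ge c\|x\|$ for all $x$. -/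

import Mathlib

noncomputable section

namespace Ellentuck

/-! ### Non-decreasing sequences and the well-order `≺` -/

/-- `ω^{↓ ≤ k}`: non-decreasing sequences of natural numbers of length at most `k`. -/
def OmLe (k : ℕ) : Type := {s : List ℕ // s.Pairwise (· ≤ ·) ∧ s.length ≤ k}

/-- `ω^{↓ k}`: non-decreasing sequences of natural numbers of length exactly `k`. -/
def Om (k : ℕ) : Type := {s : List ℕ // s.Pairwise (· ≤ ·) ∧ s.length = k}

instance (k : ℕ) : DecidableEq (Om k) := Classical.decEq _

/-- A sequence of length `k` seen as a sequence of length at most `k`. -/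
def Om.toOmLe {k : ℕ} (u : Om k) : OmLe k := ⟨u.1, u.2.1, u.2.2.le⟩

/-- The order `≺` on finite sequences: the empty sequence lies below every non-empty one; two
non-empty sequences are compared by their last terms first and then lexicographically
(`<` on `List ℕ` is the lexicographic order, where a proper initial segment is smaller). -/
def Prec (s t : List ℕ) : Prop :=
  (s = [] ∧ t ≠ []) ∨
    ∃ (hs : s ≠ []) (ht : t ≠ []),
      s.getLast hs < t.getLast ht ∨ (s.getLast hs = t.getLast ht ∧ s < t)

/-- The relation `s ⊏ t`: `s` is a proper initial segment of `t`. -/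
def ProperInit (s t : List ℕ) : Prop := s <+: t ∧ s.length < t.length

theorem Prec.irrefl (s : List ℕ) : ¬ Prec s s := by
  rintro (⟨h, h'⟩ | ⟨_, _, h | ⟨_, h⟩⟩)
  · exact h' h
  · exact lt_irrefl _ h
  · exact lt_irrefl _ h

/-! ### The space `𝓔_k` and its finite approximations -/

/-- An `𝓔_k`-tree: a map of `ω^{↓ ≤ k}` to itself that preserves `≺` and `⊏`. -/
structure ETree (k : ℕ) where
  toFun : OmLe k → OmLe k
  map_prec : ∀ s t : OmLe k, Prec s.1 t.1 → Prec (toFun s).1 (toFun t).1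
  map_init : ∀ s t : OmLe k, ProperInit s.1 t.1 → ProperInit (toFun s).1 (toFun t).1

theorem ETree.length_le {k : ℕ} (X : ETree k) :
    ∀ (n : ℕ) (s : OmLe k), s.1.length = n → n ≤ (X.toFun s).1.length := by
  intro n
  induction n with
  | zero => intro s _; exact Nat.zero_le _
  | succ n ih =>
    intro s hs
    have hl : s.1.dropLast.length = n := by simp [hs]
    let s' : OmLe k := ⟨s.1.dropLast, s.2.1.sublist (List.dropLast_sublist _), by
      have := s.2.2; omega⟩
    have h1 := ih s' hl
    have h2 := (X.map_init s' s ⟨List.dropLast_prefix _, by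
      show s.1.dropLast.length < _; omega⟩).2
    omega

/-- The restriction of an `𝓔_k`-tree to `ω^{↓ k}`; it takes values in `ω^{↓ k}`. -/
def ETree.restr {k : ℕ} (X : ETree k) (u : Om k) : Om k :=
  ⟨(X.toFun u.toOmLe).1, (X.toFun u.toOmLe).2.1,
    le_antisymm (X.toFun u.toOmLe).2.2 (X.length_le k u.toOmLe u.2.2)⟩

/-- The space `𝓔_k`, each member being identified with its range. -/
def ESpace (k : ℕ) : Set (Set (Om k)) := {A | ∃ X : ETree k, A = Set.range X.restr}

/-- `E = r_n(A)`: `E` consists of the `≺`-least `n` members of `A`. -/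
def IsRestriction {k : ℕ} (n : ℕ) (A : Set (Om k)) (E : Finset (Om k)) : Prop :=
  (E : Set (Om k)) ⊆ A ∧ E.card = n ∧ ∀ v ∈ E, ∀ w ∈ A, w ∉ E → Prec v.1 w.1

/-- `𝓐𝓡^k`: the non-empty finite approximations `r_n(A)` to members `A` of `𝓔_k`. -/
def AR (k : ℕ) : Set (Finset (Om k)) :=
  {E | E.Nonempty ∧ ∃ A ∈ ESpace k, ∃ n : ℕ, IsRestriction n A E}

/-- `E < F`: every element of `E` lies `≺`-below every element of `F`
(for non-empty `E` and `F`: `max E ≺ min F`). -/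
def SetLT {k : ℕ} (E F : Finset (Om k)) : Prop := ∀ v ∈ E, ∀ w ∈ F, Prec v.1 w.1

/-- Admissible sequences `E_1 < E_2 < ⋯ < E_m` in `𝓐𝓡^k`. -/
def Admissible {k m : ℕ} (E : Fin m → Finset (Om k)) : Prop :=
  (∀ i, E i ∈ AR k) ∧ ∀ i j, i < j → SetLT (E i) (E j)

/-! ### The norm of `T_k(d, θ)` on finitely supported vectors -/

/-- The coordinate projection `E x = ∑_{v ∈ E} x_v e_v`. -/
def proj {k : ℕ} (E : Finset (Om k)) (x : Om k →₀ ℝ) : Om k →₀ ℝ := x.filter (· ∈ E)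

/-- The sums `∑_{i=1}^m N(E_i x)` over all admissible `(E_i)_{i=1}^m` with `1 ≤ m ≤ d`. -/
def admSums {k : ℕ} (d : ℕ) (N : (Om k →₀ ℝ) → ℝ) (x : Om k →₀ ℝ) : Set ℝ :=
  {r | ∃ m : ℕ, 1 ≤ m ∧ m ≤ d ∧ ∃ E : Fin m → Finset (Om k),
    Admissible E ∧ r = ∑ i, N (proj (E i) x)}

/-- The norms `|x|_j`:  `|x|_0 = max_v |x_v|` and
`|x|_{j+1} = max {|x|_j, θ max ∑_i |E_i x|_j}`. -/
def preNorm {k : ℕ} (d : ℕ) (θ : ℝ) : ℕ → (Om k →₀ ℝ) → ℝ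
  | 0, x => ⨆ v, |x v|
  | j + 1, x => max (preNorm d θ j x) (θ * sSup (admSums d (preNorm d θ j) x))

/-- The norm `‖x‖ = sup_j |x|_j`. -/
def tNorm {k : ℕ} (d : ℕ) (θ : ℝ) (x : Om k →₀ ℝ) : ℝ := ⨆ j, preNorm d θ j x

/-! ### Verification that this is a norm -/

/-- The `ℓ_1`-norm, used as an upper bound. -/
def l1 {k : ℕ} (x : Om k →₀ ℝ) : ℝ := ∑ v ∈ x.support, |x v|

theorem proj_add {k : ℕ} (E : Finset (Om k)) (x y : Om k →₀ ℝ) :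
    proj E (x + y) = proj E x + proj E y := Finsupp.filter_add

theorem proj_smul {k : ℕ} (E : Finset (Om k)) (c : ℝ) (x : Om k →₀ ℝ) :
    proj E (c • x) = c • proj E x := Finsupp.filter_smul

theorem proj_zero {k : ℕ} (E : Finset (Om k)) : proj E (0 : Om k →₀ ℝ) = 0 :=
  Finsupp.filter_zero _

theorem l1_nonneg {k : ℕ} (x : Om k →₀ ℝ) : 0 ≤ l1 x :=
  Finset.sum_nonneg fun _ _ => abs_nonneg _

theorem abs_le_l1 {k : ℕ} (x : Om k →₀ ℝ) (v : Om k) : |x v| ≤ l1 x := by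
  by_cases hv : v ∈ x.support
  · exact Finset.single_le_sum (f := fun v => |x v|) (fun _ _ => abs_nonneg _) hv
  · rw [Finsupp.notMem_support_iff.mp hv, abs_zero]; exact l1_nonneg x

theorem l1_proj {k : ℕ} (E : Finset (Om k)) (x : Om k →₀ ℝ) :
    l1 (proj E x) = ∑ v ∈ x.support.filter (· ∈ E), |x v| := by
  unfold l1 proj
  rw [Finsupp.support_filter]
  refine Finset.sum_congr rfl fun v hv => ?_
  rw [Finsupp.filter_apply_pos _ _ (Finset.mem_filter.mp hv).2]

theorem sum_l1_proj_le {k m : ℕ} (E : Fin m → Finset (Om k)) (hE : Admissible E)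
    (x : Om k →₀ ℝ) : ∑ i, l1 (proj (E i) x) ≤ l1 x := by
  simp only [l1_proj]
  rw [← Finset.sum_biUnion]
  · refine Finset.sum_le_sum_of_subset_of_nonneg ?_ fun _ _ _ => abs_nonneg _
    intro v hv
    obtain ⟨i, _, hi⟩ := Finset.mem_biUnion.mp hv
    exact (Finset.mem_filter.mp hi).1
  · intro i _ j _ hij
    refine Finset.disjoint_left.mpr fun v hv hv' => ?_
    have h1 := (Finset.mem_filter.mp hv).2
    have h2 := (Finset.mem_filter.mp hv').2
    rcases lt_or_gt_of_ne hij with h | h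
    · exact Prec.irrefl _ (hE.2 _ _ h v h1 v h2)
    · exact Prec.irrefl _ (hE.2 _ _ h v h2 v h1)

theorem bddAbove_coord {k : ℕ} (x : Om k →₀ ℝ) : BddAbove (Set.range fun v => |x v|) :=
  ⟨l1 x, by rintro _ ⟨v, rfl⟩; exact abs_le_l1 x v⟩

theorem preNorm_nonneg {k : ℕ} (d : ℕ) (θ : ℝ) (j : ℕ) (x : Om k →₀ ℝ) :
    0 ≤ preNorm d θ j x := by
  induction j with
  | zero => exact Real.iSup_nonneg fun _ => abs_nonneg _
  | succ j ih => exact le_max_of_le_left ih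

theorem admSums_le {k : ℕ} (d : ℕ) {N : (Om k →₀ ℝ) → ℝ} (hN : ∀ x, N x ≤ l1 x)
    (x : Om k →₀ ℝ) : ∀ r ∈ admSums d N x, r ≤ l1 x := by
  rintro _ ⟨m, _, _, E, hE, rfl⟩
  exact (Finset.sum_le_sum fun i _ => hN _).trans (sum_l1_proj_le E hE x)

theorem preNorm_le_l1 {k : ℕ} (d : ℕ) {θ : ℝ} (h0 : 0 ≤ θ) (h1 : θ ≤ 1) (j : ℕ) :
    ∀ x : Om k →₀ ℝ, preNorm d θ j x ≤ l1 x := by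
  induction j with
  | zero => exact fun x => Real.iSup_le (abs_le_l1 x) (l1_nonneg x)
  | succ j ih =>
    intro x
    refine max_le (ih x) ?_
    have hs : sSup (admSums d (preNorm d θ j) x) ≤ l1 x :=
      Real.sSup_le (admSums_le d ih x) (l1_nonneg x)
    calc θ * sSup (admSums d (preNorm d θ j) x) ≤ θ * l1 x := mul_le_mul_of_nonneg_left hs h0
      _ ≤ 1 * l1 x := mul_le_mul_of_nonneg_right h1 (l1_nonneg x)
      _ = l1 x := one_mul _

theorem sSup_admSums_nonneg {k : ℕ} (d : ℕ) (θ : ℝ) (j : ℕ) (x : Om k →₀ ℝ) :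
    0 ≤ sSup (admSums d (preNorm d θ j) x) := by
  refine Real.sSup_nonneg ?_
  rintro _ ⟨m, _, _, E, _, rfl⟩
  exact Finset.sum_nonneg fun _ _ => preNorm_nonneg _ _ _ _

theorem preNorm_add {k : ℕ} (d : ℕ) {θ : ℝ} (h0 : 0 ≤ θ) (h1 : θ ≤ 1) (j : ℕ) :
    ∀ x y : Om k →₀ ℝ, preNorm d θ j (x + y) ≤ preNorm d θ j x + preNorm d θ j y := by
  induction j with
  | zero =>
    intro x y
    refine Real.iSup_le (fun v => ?_) (add_nonneg (preNorm_nonneg d θ 0 x) (preNorm_nonneg d θ 0 y))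
    rw [Finsupp.add_apply]
    exact (abs_add_le _ _).trans
      (add_le_add (le_ciSup (bddAbove_coord x) v) (le_ciSup (bddAbove_coord y) v))
  | succ j ih =>
    intro x y
    have hb : ∀ z : Om k →₀ ℝ, BddAbove (admSums d (preNorm d θ j) z) := fun z =>
      ⟨l1 z, fun r hr => admSums_le d (preNorm_le_l1 d h0 h1 j) z r hr⟩
    refine max_le ((ih x y).trans (add_le_add (le_max_left _ _) (le_max_left _ _))) ?_
    have hs : sSup (admSums d (preNorm d θ j) (x + y)) ≤
        sSup (admSums d (preNorm d θ j) x) + sSup (admSums d (preNorm d θ j) y) := by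
      refine Real.sSup_le ?_ (add_nonneg (sSup_admSums_nonneg _ _ _ _) (sSup_admSums_nonneg _ _ _ _))
      rintro _ ⟨m, hm1, hm2, E, hE, rfl⟩
      refine le_trans ?_ (add_le_add (le_csSup (hb x) ⟨m, hm1, hm2, E, hE, rfl⟩)
        (le_csSup (hb y) ⟨m, hm1, hm2, E, hE, rfl⟩))
      rw [← Finset.sum_add_distrib]
      refine Finset.sum_le_sum fun i _ => ?_
      rw [proj_add]; exact ih _ _
    calc _ ≤ θ * (sSup (admSums d (preNorm d θ j) x) + sSup (admSums d (preNorm d θ j) y)) :=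
          mul_le_mul_of_nonneg_left hs h0
      _ = θ * sSup (admSums d (preNorm d θ j) x) + θ * sSup (admSums d (preNorm d θ j) y) :=
          mul_add _ _ _
      _ ≤ _ := add_le_add (le_max_right _ _) (le_max_right _ _)

open scoped Pointwise in
theorem preNorm_smul {k : ℕ} (d : ℕ) (θ : ℝ) (j : ℕ) (c : ℝ) :
    ∀ x : Om k →₀ ℝ, preNorm d θ j (c • x) = |c| * preNorm d θ j x := by
  induction j with
  | zero =>
    intro x
    simp only [preNorm, Finsupp.smul_apply, smul_eq_mul, abs_mul]
    exact (Real.mul_iSup_of_nonneg (abs_nonneg c) _).symm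
  | succ j ih =>
    intro x
    have hset : admSums d (preNorm d θ j) (c • x) = |c| • admSums d (preNorm d θ j) x := by
      ext r
      constructor
      · rintro ⟨m, hm1, hm2, E, hE, rfl⟩
        refine ⟨_, ⟨m, hm1, hm2, E, hE, rfl⟩, ?_⟩
        simp only [smul_eq_mul, Finset.mul_sum, proj_smul, ih]
      · rintro ⟨_, ⟨m, hm1, hm2, E, hE, rfl⟩, rfl⟩
        refine ⟨m, hm1, hm2, E, hE, ?_⟩
        simp only [smul_eq_mul, Finset.mul_sum, proj_smul, ih]
    simp only [preNorm]
    rw [ih, hset, Real.sSup_smul_of_nonneg (abs_nonneg c), smul_eq_mul,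
      mul_max_of_nonneg _ _ (abs_nonneg c)]
    congr 1
    ring

theorem bddAbove_preNorm {k : ℕ} (d : ℕ) {θ : ℝ} (h0 : 0 ≤ θ) (h1 : θ ≤ 1) (x : Om k →₀ ℝ) :
    BddAbove (Set.range fun j => preNorm d θ j x) :=
  ⟨l1 x, by rintro _ ⟨j, rfl⟩; exact preNorm_le_l1 d h0 h1 j x⟩

theorem tNorm_nonneg {k : ℕ} (d : ℕ) (θ : ℝ) (x : Om k →₀ ℝ) : 0 ≤ tNorm d θ x :=
  Real.iSup_nonneg fun j => preNorm_nonneg d θ j x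

theorem tNorm_add {k : ℕ} (d : ℕ) {θ : ℝ} (h0 : 0 ≤ θ) (h1 : θ ≤ 1) (x y : Om k →₀ ℝ) :
    tNorm d θ (x + y) ≤ tNorm d θ x + tNorm d θ y :=
  ciSup_le fun j => (preNorm_add d h0 h1 j x y).trans
    (add_le_add (le_ciSup (bddAbove_preNorm d h0 h1 x) j)
      (le_ciSup (bddAbove_preNorm d h0 h1 y) j))

theorem tNorm_smul {k : ℕ} (d : ℕ) (θ : ℝ) (c : ℝ) (x : Om k →₀ ℝ) :
    tNorm d θ (c • x) = |c| * tNorm d θ x := by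
  simp only [tNorm, preNorm_smul]
  exact (Real.mul_iSup_of_nonneg (abs_nonneg c) _).symm

theorem eq_zero_of_tNorm {k : ℕ} (d : ℕ) {θ : ℝ} (h0 : 0 ≤ θ) (h1 : θ ≤ 1) (x : Om k →₀ ℝ)
    (h : tNorm d θ x = 0) : x = 0 := by
  ext v
  have h2 : |x v| ≤ tNorm d θ x :=
    (le_ciSup (bddAbove_coord x) v).trans (le_ciSup (bddAbove_preNorm d h0 h1 x) 0)
  exact abs_nonpos_iff.mp (h2.trans h.le)

/-! ### The Banach space `T_k(d, θ)` -/

/-- The vector space `c_{00}(ω^{↓ k})`, to be normed by `‖·‖_{T_k(d, θ)}`. -/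
def C00 (k _d : ℕ) (_θ : Set.Ioo (0 : ℝ) 1) : Type := Om k →₀ ℝ

instance (k d : ℕ) (θ : Set.Ioo (0 : ℝ) 1) : AddCommGroup (C00 k d θ) :=
  inferInstanceAs (AddCommGroup (Om k →₀ ℝ))

instance (k d : ℕ) (θ : Set.Ioo (0 : ℝ) 1) : Module ℝ (C00 k d θ) :=
  inferInstanceAs (Module ℝ (Om k →₀ ℝ))

instance (k d : ℕ) (θ : Set.Ioo (0 : ℝ) 1) : Norm (C00 k d θ) :=
  ⟨fun x => tNorm (k := k) d θ.1 x⟩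

theorem C00.core (k d : ℕ) (θ : Set.Ioo (0 : ℝ) 1) : NormedSpace.Core ℝ (C00 k d θ) where
  norm_nonneg x := tNorm_nonneg (k := k) d θ.1 x
  norm_smul c x := tNorm_smul (k := k) d θ.1 c x
  norm_triangle x y := tNorm_add (k := k) d θ.2.1.le θ.2.2.le x y
  norm_eq_zero_iff x := by
    refine ⟨eq_zero_of_tNorm (k := k) d θ.2.1.le θ.2.2.le x, ?_⟩
    rintro rfl
    have h := tNorm_smul (k := k) d θ.1 0 0
    rw [zero_smul, abs_zero, zero_mul] at h
    exact h

instance (k d : ℕ) (θ : Set.Ioo (0 : ℝ) 1) : NormedAddCommGroup (C00 k d θ) :=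
  NormedAddCommGroup.ofCore (C00.core k d θ)

instance (k d : ℕ) (θ : Set.Ioo (0 : ℝ) 1) : NormedSpace ℝ (C00 k d θ) :=
  NormedSpace.ofCore (C00.core k d θ)

/-- `T_k(d, θ)`: the completion of `c_{00}(ω^{↓ k})` for the norm `‖·‖_{T_k(d, θ)}`. -/
abbrev TSpace (k d : ℕ) (θ : Set.Ioo (0 : ℝ) 1) : Type := UniformSpace.Completion (C00 k d θ)

/-- `X` embeds into `Y`: there is a bounded linear map from `X` to `Y` that is bounded below,
i.e. an isomorphism of `X` onto a closed subspace of `Y` when `X` is complete. -/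
def Embeds (X Y : Type*) [NormedAddCommGroup X] [NormedSpace ℝ X] [NormedAddCommGroup Y]
    [NormedSpace ℝ Y] : Prop :=
  ∃ Φ : X →L[ℝ] Y, ∃ c : ℝ, 0 < c ∧ ∀ x, c * ‖x‖ ≤ ‖Φ x‖

end Ellentuck

end

noncomputable section

namespace Ellentuck

open Filter Topology

/-! Both parts follow from the non-embedding for `k₂ < k₁`. View `ω^{↓ k}` as a tree in which `Cone
k t m` collects the continuations of the node `t` by entries at least `m`. Two estimates pull in
opposite directions. In a fixed cone, `d ^ j` successive blocks have a sum of norm at least `θ ^ j`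
times the sum of their norms (`pow_mul_sum_tNorm_le`), so normalized blocks give at least `(dθ) ^
j`, which is unbounded because `dθ > 1`. Normalized vectors in distinct columns over a node,
supported far enough out, have a sum of norm at most `d / (1 - θ)`, however many they are
(`tNorm_le_of_columns`).

An operator bounded below may be assumed to preserve finite supports (`Embeds.exists_linearMap`). It
is contradicted by `exists_small`: inside a suitable cone of the source there are unit vectors whose
images are arbitrarily small on finitely many given cones of the target. The induction is on the
height `l` of the target cones, the source cone having height `l + 1`. If smallness failed, one
would choose far out unit vectors in `d ^ j` distinct columns whose images, by the inductive
hypothesis, almost vanish on the columns already reached. On each target cone the images are then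
essentially successive blocks, so the image of a sum of bounded norm grows like `(dθ) ^ j`. With `k₂
< k₁` the source has the extra level needed to reach `l = k₂`, where a single cone is the whole
target. -/

/-! ### Coordinate restrictions -/

open scoped Classical in
/-- The restriction of `x` to an arbitrary set of coordinates. -/
def restr {k : ℕ} (A : Set (Om k)) (x : Om k →₀ ℝ) : Om k →₀ ℝ := x.filter (· ∈ A)

theorem restr_apply_mem {k : ℕ} {A : Set (Om k)} (x : Om k →₀ ℝ) {v : Om k} (h : v ∈ A) :
    restr A x v = x v := by
  classical exact Finsupp.filter_apply_pos _ _ h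

theorem restr_apply_notMem {k : ℕ} {A : Set (Om k)} (x : Om k →₀ ℝ) {v : Om k} (h : v ∉ A) :
    restr A x v = 0 := by
  classical exact Finsupp.filter_apply_neg _ _ h

open scoped Classical in
theorem restr_apply {k : ℕ} (A : Set (Om k)) (x : Om k →₀ ℝ) (v : Om k) :
    restr A x v = if v ∈ A then x v else 0 := by
  split_ifs with h
  exacts [restr_apply_mem x h, restr_apply_notMem x h]

theorem restr_add {k : ℕ} (A : Set (Om k)) (x y : Om k →₀ ℝ) :
    restr A (x + y) = restr A x + restr A y := by
  classical exact Finsupp.filter_add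

theorem restr_smul {k : ℕ} (A : Set (Om k)) (c : ℝ) (x : Om k →₀ ℝ) :
    restr A (c • x) = c • restr A x := by
  classical exact Finsupp.filter_smul

/-- Restriction to a set of coordinates as a linear map. -/
def restrₗ {k : ℕ} (A : Set (Om k)) : (Om k →₀ ℝ) →ₗ[ℝ] (Om k →₀ ℝ) where
  toFun := restr A
  map_add' := restr_add A
  map_smul' := restr_smul A

theorem restr_sum {k : ℕ} (A : Set (Om k)) {ι : Type*} (S : Finset ι) (x : ι → Om k →₀ ℝ) :
    restr A (∑ i ∈ S, x i) = ∑ i ∈ S, restr A (x i) :=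
  map_sum (restrₗ A) x S

theorem proj_eq_restr {k : ℕ} (E : Finset (Om k)) (x : Om k →₀ ℝ) :
    proj E x = restr (E : Set (Om k)) x := by
  classical
  ext v
  simp [proj, restr_apply, Finsupp.filter_apply]

theorem restr_restr {k : ℕ} (A B : Set (Om k)) (x : Om k →₀ ℝ) :
    restr A (restr B x) = restr (A ∩ B) x := by
  classical
  ext v
  simp only [restr_apply, Set.mem_inter_iff]
  split_ifs <;> simp_all

theorem restr_comm {k : ℕ} (A B : Set (Om k)) (x : Om k →₀ ℝ) :
    restr A (restr B x) = restr B (restr A x) := by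
  rw [restr_restr, restr_restr, Set.inter_comm]

theorem restr_eq_self {k : ℕ} {A : Set (Om k)} {x : Om k →₀ ℝ}
    (h : ∀ v, x v ≠ 0 → v ∈ A) : restr A x = x := by
  classical
  ext v
  rw [restr_apply]
  split_ifs with hv
  · rfl
  · by_contra hne
    exact hv (h v (Ne.symm hne))

theorem restr_eq_zero {k : ℕ} {A : Set (Om k)} {x : Om k →₀ ℝ}
    (h : ∀ v, x v ≠ 0 → v ∉ A) : restr A x = 0 := by
  classical
  ext v
  rw [restr_apply]
  split_ifs with hv
  · by_contra hne
    exact h v hne hv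
  · rfl

theorem mem_of_restr_ne_zero {k : ℕ} {A : Set (Om k)} {x : Om k →₀ ℝ} {v : Om k}
    (h : restr A x v ≠ 0) : v ∈ A ∧ x v ≠ 0 := by
  classical
  rw [restr_apply] at h
  split_ifs at h with hv
  exacts [⟨hv, h⟩, absurd rfl h]

/-! ### Basic properties of the norm -/

section Norm

variable {k d : ℕ} {θ : ℝ}

theorem preNorm_restr_le (h0 : 0 ≤ θ) (h1 : θ ≤ 1) (A : Set (Om k)) (j : ℕ) :
    ∀ x : Om k →₀ ℝ, preNorm d θ j (restr A x) ≤ preNorm d θ j x := by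
  classical
  induction j with
  | zero =>
    intro x
    refine Real.iSup_le (fun v => ?_) (preNorm_nonneg d θ 0 x)
    refine le_trans ?_ (le_ciSup (bddAbove_coord x) v)
    rw [restr_apply]
    split_ifs
    · exact le_rfl
    · simp
  | succ j ih =>
    intro x
    refine max_le_max (ih x) (mul_le_mul_of_nonneg_left ?_ h0)
    refine Real.sSup_le ?_ (sSup_admSums_nonneg d θ j x)
    rintro _ ⟨m, hm1, hm2, E, hE, rfl⟩
    refine le_trans ?_ (le_csSup ⟨l1 x, fun r hr => admSums_le d (preNorm_le_l1 d h0 h1 j) x r hr⟩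
      ⟨m, hm1, hm2, E, hE, rfl⟩)
    refine Finset.sum_le_sum fun i _ => ?_
    rw [proj_eq_restr, restr_comm, ← proj_eq_restr]
    exact ih _

theorem preNorm_le_tNorm (h0 : 0 ≤ θ) (h1 : θ ≤ 1) (j : ℕ) (x : Om k →₀ ℝ) :
    preNorm d θ j x ≤ tNorm d θ x :=
  le_ciSup (bddAbove_preNorm d h0 h1 x) j

theorem tNorm_restr_le (h0 : 0 ≤ θ) (h1 : θ ≤ 1) (A : Set (Om k)) (x : Om k →₀ ℝ) :
    tNorm d θ (restr A x) ≤ tNorm d θ x :=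
  ciSup_le fun j => (preNorm_restr_le h0 h1 A j x).trans (preNorm_le_tNorm h0 h1 j x)

theorem abs_apply_le_tNorm (h0 : 0 ≤ θ) (h1 : θ ≤ 1) (x : Om k →₀ ℝ) (v : Om k) :
    |x v| ≤ tNorm d θ x :=
  (le_ciSup (bddAbove_coord x) v).trans (preNorm_le_tNorm h0 h1 0 x)

theorem preNorm_monotone (x : Om k →₀ ℝ) : Monotone fun j => preNorm d θ j x :=
  monotone_nat_of_le_succ fun _ => le_max_left _ _

theorem tNorm_zero : tNorm d θ (0 : Om k →₀ ℝ) = 0 := by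
  simpa using tNorm_smul d θ 0 (0 : Om k →₀ ℝ)

theorem tNorm_sum_le (h0 : 0 ≤ θ) (h1 : θ ≤ 1) {ι : Type*} (S : Finset ι) (x : ι → Om k →₀ ℝ) :
    tNorm d θ (∑ i ∈ S, x i) ≤ ∑ i ∈ S, tNorm d θ (x i) := by
  classical
  induction S using Finset.induction_on with
  | empty => simp [tNorm_zero]
  | insert a S ha ih =>
    rw [Finset.sum_insert ha, Finset.sum_insert ha]
    exact (tNorm_add d h0 h1 _ _).trans (by gcongr)

/-- The implicit lower estimate satisfied by the norm. -/
theorem mul_sum_tNorm_le (h0 : 0 ≤ θ) (h1 : θ ≤ 1) {m : ℕ} (hm : 1 ≤ m) (hmd : m ≤ d)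
    {E : Fin m → Finset (Om k)} (hE : Admissible E) (x : Om k →₀ ℝ) :
    θ * ∑ i, tNorm d θ (proj (E i) x) ≤ tNorm d θ x := by
  -- The inequality between levels `j` and `j + 1` is part of the recursion; monotonicity in `j`
  -- carries it to the limit.
  have ht : Tendsto (fun j => θ * ∑ i, preNorm d θ j (proj (E i) x)) atTop
      (𝓝 (θ * ∑ i, tNorm d θ (proj (E i) x))) :=
    (tendsto_finsetSum _ fun i _ =>
      tendsto_atTop_ciSup (preNorm_monotone _) (bddAbove_preNorm d h0 h1 _)).const_mul θ
  refine le_of_tendsto' ht fun j => le_trans ?_ (preNorm_le_tNorm h0 h1 (j + 1) x)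
  refine le_trans (mul_le_mul_of_nonneg_left ?_ h0) (le_max_right _ _)
  exact le_csSup ⟨l1 x, fun r hr => admSums_le d (preNorm_le_l1 d h0 h1 j) x r hr⟩
    ⟨m, hm, hmd, E, hE, rfl⟩

end Norm

/-! ### Cones -/

/-- The elements of `ω^{↓ k}` extending `t` by numbers that are at least `m`. -/
def Cone (k : ℕ) (t : List ℕ) (m : ℕ) : Set (Om k) :=
  {u | ∃ v, u.1 = t ++ v ∧ ∀ a ∈ v, m ≤ a}

theorem Cone.anti {k : ℕ} (t : List ℕ) {m n : ℕ} (h : m ≤ n) : Cone k t n ⊆ Cone k t m := by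
  rintro u ⟨v, hv, hm⟩
  exact ⟨v, hv, fun a ha => h.trans (hm a ha)⟩

theorem Cone.append_subset {k : ℕ} (t : List ℕ) {m i n : ℕ} (hi : m ≤ i) (hn : m ≤ n) :
    Cone k (t ++ [i]) n ⊆ Cone k t m := by
  rintro u ⟨v, hv, hm⟩
  refine ⟨i :: v, by simp [hv], ?_⟩
  intro a ha
  rcases List.mem_cons.1 ha with rfl | ha
  exacts [hi, hn.trans (hm a ha)]

theorem Cone.eq_of_mem {k : ℕ} {s t : List ℕ} (hl : s.length = t.length) {m n : ℕ} {u : Om k}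
    (hs : u ∈ Cone k s m) (ht : u ∈ Cone k t n) : s = t := by
  obtain ⟨v, hv, -⟩ := hs
  obtain ⟨w, hw, -⟩ := ht
  exact (List.append_inj (hv.symm.trans hw) hl).1

/-- The first entry after `t` decides: by monotonicity all later entries are at least as large. -/
theorem Cone.mem_or {k : ℕ} {t : List ℕ} (ht : t.length < k) {u : Om k}
    (hu : u ∈ Cone k t 0) (m : ℕ) :
    u ∈ Cone k t m ∨ ∃ j < m, u ∈ Cone k (t ++ [j]) 0 := by
  obtain ⟨v, hv, -⟩ := hu
  match v, hv with
  | [], hv => 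
    have := congrArg List.length hv
    rw [u.2.2] at this
    simp at this; omega
  | j :: v, hv =>
    by_cases hj : j < m
    · exact Or.inr ⟨j, hj, v, by simp [hv], by simp⟩
    · left
      refine ⟨j :: v, hv, ?_⟩
      have hp := u.2.1
      rw [hv, List.pairwise_append] at hp
      have := List.pairwise_cons.1 hp.2.1
      intro a ha
      rcases List.mem_cons.1 ha with rfl | ha
      · omega
      · have := this.1 a ha; omega

/-! ### Comparing sequences in the order `≺` -/

theorem le_getLast_of_pairwise {s : List ℕ} (hs : s.Pairwise (· ≤ ·)) {a : ℕ} (ha : a ∈ s)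
    (hne : s ≠ []) : a ≤ s.getLast hne := by
  rcases List.eq_nil_or_concat' s with rfl | ⟨l, b, rfl⟩
  · exact absurd rfl hne
  · rw [List.getLast_append_singleton]
    rw [List.pairwise_append] at hs
    rcases List.mem_append.1 ha with h | h
    · exact hs.2.2 a h b (by simp)
    · simp_all

theorem prec_of_forall_lt {s t : List ℕ} (ht : t.Pairwise (· ≤ ·)) {q b : ℕ}
    (hs : ∀ a ∈ s, a < q) (hb : b ∈ t) (hq : q ≤ b) : Prec s t := by
  have htne : t ≠ [] := List.ne_nil_of_mem hb
  by_cases h : s = []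
  · exact Or.inl ⟨h, htne⟩
  · exact Or.inr ⟨h, htne, Or.inl ((hs _ (List.getLast_mem h)).trans_le
      (hq.trans (le_getLast_of_pairwise ht hb htne)))⟩

theorem exists_le_of_prec {s t : List ℕ} (hs : s.Pairwise (· ≤ ·)) (h : Prec s t) {a : ℕ}
    (ha : a ∈ s) : ∃ b ∈ t, a ≤ b := by
  rcases h with ⟨rfl, -⟩ | ⟨hsn, htn, h⟩
  · simp at ha
  · refine ⟨t.getLast htn, List.getLast_mem htn, (le_getLast_of_pairwise hs ha hsn).trans ?_⟩
    rcases h with h | h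
    exacts [h.le, h.1.le]

theorem prec_append_singleton_iff {s t : List ℕ} {a b : ℕ} :
    Prec (s ++ [a]) (t ++ [b]) ↔ a < b ∨ (a = b ∧ s ++ [a] < t ++ [b]) := by
  simp [Prec]

/-! ### Trees grafted on a given node -/

/-- `graft t p s` replaces the entries `a` of `s` by `p + a`, except that a zero in a position of `t`
is replaced by the entry of `t` in that position. -/
def graft : List ℕ → ℕ → List ℕ → List ℕ
  | _, _, [] => []
  | [], p, a :: s => (p + a) :: graft [] p s
  | b :: t, p, a :: s => (if a = 0 then b else p + a) :: graft t p s

@[simp] theorem graft_nil (t : List ℕ) (p : ℕ) : graft t p [] = [] := by cases t <;> rfl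

@[simp] theorem length_graft (t : List ℕ) (p : ℕ) (s : List ℕ) :
    (graft t p s).length = s.length := by
  induction s generalizing t with
  | nil => simp
  | cons a s ih => cases t <;> simp [graft, ih]

theorem graft_append (t : List ℕ) (p : ℕ) (s r : List ℕ) :
    graft t p (s ++ r) = graft t p s ++ graft (t.drop s.length) p r := by
  induction s generalizing t with
  | nil => simp
  | cons a s ih => cases t <;> simp [graft, ih]

theorem graft_nil_left (p : ℕ) (s : List ℕ) : graft [] p s = s.map (p + ·) := by
  induction s with
  | nil => rfl
  | cons a s ih => simp [graft, ih]

theorem mem_graft {t : List ℕ} {p : ℕ} {s : List ℕ} {c : ℕ} (h : c ∈ graft t p s) :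
    c ∈ t ∨ ∃ a ∈ s, c = p + a := by
  induction s generalizing t with
  | nil => simp at h
  | cons a s ih =>
    cases t with
    | nil =>
      rcases List.mem_cons.1 h with rfl | h
      · exact Or.inr ⟨a, by simp, rfl⟩
      · rcases ih h with h | ⟨a', h', rfl⟩
        · exact Or.inl h
        · exact Or.inr ⟨a', List.mem_cons_of_mem _ h', rfl⟩
    | cons b t =>
      rcases List.mem_cons.1 h with rfl | h
      · split_ifs
        · simp
        · exact Or.inr ⟨a, by simp, rfl⟩
      · rcases ih h with h | ⟨a', h', rfl⟩
        · simp [h]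
        · exact Or.inr ⟨a', List.mem_cons_of_mem _ h', rfl⟩

theorem exists_le_mem_graft {t : List ℕ} (p : ℕ) {s : List ℕ} (h : t.length < s.length) :
    ∃ c ∈ graft t p s, p ≤ c := by
  induction s generalizing t with
  | nil => simp at h
  | cons a s ih =>
    cases t with
    | nil => exact ⟨p + a, by simp [graft], by omega⟩
    | cons b t =>
      obtain ⟨c, hc, hp⟩ := ih (t := t) (by simpa using h)
      exact ⟨c, by simp [graft, hc], hp⟩

theorem graft_lt {t : List ℕ} {p : ℕ} (ht : ∀ b ∈ t, b ≤ p) {s s' : List ℕ} (h : s < s') :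
    graft t p s < graft t p s' := by
  induction s generalizing t s' with
  | nil =>
    cases s' with
    | nil => simp at h
    | cons a s' => cases t <;> simp [graft]
  | cons a s ih =>
    cases s' with
    | nil => simp at h
    | cons a' s' =>
      rw [List.cons_lt_cons_iff] at h
      cases t with
      | nil =>
        simp only [graft, List.cons_lt_cons_iff]
        rcases h with h | ⟨rfl, h⟩
        · left; omega
        · exact Or.inr ⟨rfl, ih ht h⟩
      | cons b t =>
        simp only [graft, List.cons_lt_cons_iff]
        have hb := ht b (by simp)
        rcases h with h | ⟨rfl, h⟩
        · left
          split_ifs <;> omega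
        · exact Or.inr ⟨rfl, ih (fun b hb => ht b (by simp [hb])) h⟩

theorem graft_pairwise {t : List ℕ} {p : ℕ} (ht : ∀ b ∈ t, b ≤ p) (htp : t.Pairwise (· ≤ ·))
    {s : List ℕ} (hs : s.Pairwise (· ≤ ·)) : (graft t p s).Pairwise (· ≤ ·) := by
  induction s generalizing t with
  | nil => simp
  | cons a s ih =>
    rw [List.pairwise_cons] at hs
    cases t with
    | nil =>
      refine List.pairwise_cons.2 ⟨fun c hc => ?_, ih ht htp hs.2⟩
      rcases mem_graft hc with h | ⟨a', h, rfl⟩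
      · simp at h
      · have := hs.1 a' h; omega
    | cons b t =>
      rw [List.pairwise_cons] at htp
      have hb := ht b (by simp)
      have ht' : ∀ b ∈ t, b ≤ p := fun b hb => ht b (by simp [hb])
      refine List.pairwise_cons.2 ⟨fun c hc => ?_, ih ht' htp.2 hs.2⟩
      split_ifs with ha
      · rcases mem_graft hc with h | ⟨a', h, rfl⟩
        · exact htp.1 c h
        · omega
      -- After a positive entry no zeros occur, so every later entry is shifted by `p` and `t` plays
      -- no role.
      · have hpos : ∀ (s t : List ℕ), (∀ a' ∈ s, a ≤ a') → c ∈ graft t p s → p + a ≤ c := by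
          intro s
          induction s with
          | nil => intro t _ hc; simp at hc
          | cons a' s ih' =>
            intro t hs hc
            have ha' := hs a' (by simp)
            cases t with
            | nil =>
              rcases List.mem_cons.1 hc with rfl | hc
              · omega
              · exact ih' [] (fun x hx => hs x (by simp [hx])) hc
            | cons b t =>
              rcases List.mem_cons.1 hc with rfl | hc
              · rw [if_neg (by omega)]; omega
              · exact ih' t (fun x hx => hs x (by simp [hx])) hc
        exact hpos s t hs.1 hc

theorem graft_singleton (t : List ℕ) (p a : ℕ) :
    ∃ c, graft t p [a] = [c] ∧ (c = p + a ∨ a = 0 ∧ c ∈ t) := by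
  cases t with
  | nil => exact ⟨_, rfl, Or.inl rfl⟩
  | cons b t =>
    refine ⟨_, rfl, ?_⟩
    split_ifs with h
    · simp [h]
    · exact Or.inl rfl

/-- Last terms decide unless they tie. A larger last term is positive, hence shifted, and the shift
dominates every entry of `t`; ties are settled by lexicographic monotonicity (`graft_lt`). -/
theorem graft_prec {t : List ℕ} {p : ℕ} (ht : ∀ b ∈ t, b ≤ p) (htp : t.Pairwise (· ≤ ·))
    {s s' : List ℕ} (hs : s.Pairwise (· ≤ ·)) (hs' : s'.Pairwise (· ≤ ·)) (h : Prec s s') :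
    Prec (graft t p s) (graft t p s') := by
  rcases List.eq_nil_or_concat' s' with rfl | ⟨l', a', rfl⟩
  · rcases h with ⟨_, h⟩ | ⟨_, h, _⟩ <;> exact absurd rfl h
  have hne : graft t p (l' ++ [a']) ≠ [] := by
    rw [← List.length_pos_iff]; simp
  rcases List.eq_nil_or_concat' s with rfl | ⟨l, a, rfl⟩
  · exact Or.inl ⟨by simp, hne⟩
  rw [prec_append_singleton_iff] at h
  have hlt := fun h => graft_lt (s := l ++ [a]) (s' := l' ++ [a']) ht h
  obtain ⟨c, hc, hc'⟩ := graft_singleton (t.drop l.length) p a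
  obtain ⟨e, he, he'⟩ := graft_singleton (t.drop l'.length) p a'
  have hcp : a = 0 ∧ c ∈ t.drop l.length → c ≤ p := fun h => ht c (List.mem_of_mem_drop h.2)
  have hprec : Prec (graft t p (l ++ [a])) (graft t p (l' ++ [a'])) ↔
      c < e ∨ (c = e ∧ graft t p (l ++ [a]) < graft t p (l' ++ [a'])) := by
    rw [graft_append, graft_append, hc, he, prec_append_singleton_iff]
  rw [hprec]
  rcases h with h | ⟨rfl, h⟩
  · left
    rcases hc' with rfl | h1 <;> rcases he' with rfl | h2
    · omega
    · omega
    · have := hcp h1; omega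
    · omega
  · by_cases ha : a = 0
    -- Two sequences ending in `0` consist of zeros only, so the smaller is a proper initial segment
    -- of the larger, and so are their images. The last terms of the images may now differ, but
    -- monotonicity of the larger image gives `c ≤ e`.
    · subst ha
      have hrep : ∀ {l : List ℕ}, (l ++ [0]).Pairwise (· ≤ ·) →
          l ++ [0] = List.replicate (l.length + 1) 0 := by
        intro l hl
        refine List.eq_replicate_iff.2 ⟨by simp, fun b hb => ?_⟩
        have := le_getLast_of_pairwise hl hb (by simp)
        simpa using this
      have h' := h
      rw [hrep hs, hrep hs'] at h'
      have hlen : l.length < l'.length := by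
        by_contra hcon
        obtain ⟨n, hn⟩ := Nat.exists_eq_add_of_le (not_lt.1 hcon)
        have hpre : List.replicate (l'.length + 1) 0 <+: List.replicate (l.length + 1) 0 := by
          refine ⟨List.replicate n 0, ?_⟩
          rw [List.replicate_append_replicate]
          congr 1; omega
        exact absurd h' (List.IsPrefix.le hpre)
      have hpre : l ++ [0] <+: l' ++ [0] := by
        rw [hrep hs, hrep hs']
        refine ⟨List.replicate (l'.length - l.length) 0, ?_⟩
        rw [List.replicate_append_replicate]
        congr 1; omega
      obtain ⟨r, hr⟩ := hpre
      have hcmem : c ∈ graft t p (l' ++ [0]) := by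
        rw [← hr, graft_append, graft_append, hc]; simp
      have hle := le_getLast_of_pairwise (graft_pairwise ht htp hs') hcmem hne
      have hlast : (graft t p (l' ++ [0])).getLast hne = e := by
        simp only [graft_append, he, List.getLast_append_singleton]
      rw [hlast] at hle
      rcases hle.lt_or_eq with h1 | h1
      · exact Or.inl h1
      · exact Or.inr ⟨h1, hlt h⟩
    · right
      refine ⟨?_, hlt h⟩
      rcases hc' with rfl | h1 <;> rcases he' with rfl | h2 <;> omega

/-- The `𝓔_k`-tree given by `graft`. -/
def graftTree (k : ℕ) {t : List ℕ} {p : ℕ} (ht : ∀ b ∈ t, b ≤ p) (htp : t.Pairwise (· ≤ ·)) :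
    ETree k where
  toFun s := ⟨graft t p s.1, graft_pairwise ht htp s.2.1, by simpa using s.2.2⟩
  map_prec s s' h := graft_prec ht htp s.2.1 s'.2.1 h
  map_init s s' h := by
    obtain ⟨⟨r, hr⟩, hl⟩ := h
    refine ⟨?_, by simpa using hl⟩
    simp only [← hr, graft_append]
    exact List.prefix_append _ _

/-- This is what `graft` is designed for: one member of `𝓔_k` contains the whole cone. The preimage
of `t ++ v` has zeros in place of `t` and `v` lowered by `p`. -/
theorem mem_range_graftTree {k : ℕ} {t : List ℕ} {p : ℕ} (ht : ∀ b ∈ t, b ≤ p)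
    (htp : t.Pairwise (· ≤ ·)) {u : Om k} (hu : u ∈ Cone k t p) :
    u ∈ Set.range (graftTree k ht htp).restr := by
  obtain ⟨v, hv, hm⟩ := hu
  have hlen := u.2.2
  have hp := u.2.1
  rw [hv, List.pairwise_append] at hp
  rw [hv, List.length_append] at hlen
  have hσ : (List.replicate t.length 0 ++ v.map (· - p)).Pairwise (· ≤ ·) := by
    rw [List.pairwise_append]
    refine ⟨List.pairwise_replicate.2 (Or.inr le_rfl), ?_, ?_⟩
    · rw [List.pairwise_map]
      exact hp.2.1.imp fun h => Nat.sub_le_sub_right h p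
    · intro a ha b _
      rw [(List.mem_replicate.1 ha).2]
      exact Nat.zero_le b
  refine ⟨⟨_, hσ, by simp [hlen]⟩, Subtype.ext ?_⟩
  have hz : ∀ t : List ℕ, graft t p (List.replicate t.length 0) = t := by
    intro t
    induction t with
    | nil => simp
    | cons b t ih => simp [graft, List.replicate_succ, ih]
  change graft t p (List.replicate t.length 0 ++ v.map (· - p)) = u.1
  rw [graft_append, hz, List.length_replicate, List.drop_length, graft_nil_left, hv, List.map_map]
  congr 1
  conv_rhs => rw [← List.map_id v]
  refine List.map_congr_left fun a ha => ?_
  have := hm a ha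
  simp only [Function.comp_apply, id_eq]
  omega

theorem finite_bounded (k q : ℕ) : {u : Om k | ∀ a ∈ u.1, a < q}.Finite := by
  have hfin : {l : List (Fin q) | l.length = k}.Finite := List.finite_length_eq _ _
  refine ((hfin.image (List.map Fin.val)).preimage
    (f := fun u : Om k => u.1) Subtype.val_injective.injOn).subset ?_
  intro u hu
  refine ⟨u.1.attach.map fun a => ⟨a.1, hu a.1 a.2⟩, by simpa using u.2.2, ?_⟩
  simp [List.map_map, Function.comp_def]

/-- Initial segments of grafted trees cover bounded subsets of cones. -/
theorem exists_AR_cover {k : ℕ} {t : List ℕ} {p q : ℕ} (hk : t.length < k)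
    (ht : ∀ b ∈ t, b ≤ p) (htp : t.Pairwise (· ≤ ·)) (hpq : p < q) :
    ∃ E ∈ AR k, (∀ u ∈ Cone k t p, (∀ a ∈ u.1, a < q) → u ∈ E) ∧
      (∀ u ∈ E, ∀ a ∈ u.1, a < q) ∧ ∀ u ∈ E, ∃ a ∈ u.1, p ≤ a := by
  have hfin : {u | u ∈ Set.range (graftTree k ht htp).restr ∧ ∀ a ∈ u.1, a < q}.Finite :=
    (finite_bounded k q).subset fun u hu => hu.2
  -- Cutting the range at entries below `q` leaves a `≺`-initial segment, since `≺` compares last,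
  -- hence largest, terms first.
  refine ⟨hfin.toFinset, ⟨?_, _, ⟨graftTree k ht htp, rfl⟩, _, ?_, rfl, ?_⟩, ?_, ?_, ?_⟩
  · refine ⟨(graftTree k ht htp).restr ⟨List.replicate k 0,
      List.pairwise_replicate.2 (Or.inr le_rfl), by simp⟩, ?_⟩
    rw [Set.Finite.mem_toFinset]
    refine ⟨⟨_, rfl⟩, fun a ha => ?_⟩
    rcases mem_graft (show a ∈ graft t p (List.replicate k 0) from ha) with h | ⟨b, hb, rfl⟩
    · exact (ht a h).trans_lt hpq
    · rw [(List.mem_replicate.1 hb).2]; exact hpq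
  · intro u hu
    exact (hfin.mem_toFinset.1 hu).1
  · intro v hv w hw hw'
    have hv := (hfin.mem_toFinset.1 hv).2
    have : ∃ b ∈ w.1, q ≤ b := by
      by_contra! hcon
      exact hw' (hfin.mem_toFinset.2 ⟨hw, hcon⟩)
    obtain ⟨b, hb, hqb⟩ := this
    exact prec_of_forall_lt w.2.1 hv hb hqb
  · intro u hu hq
    exact hfin.mem_toFinset.2 ⟨mem_range_graftTree ht htp hu, hq⟩
  · intro u hu
    exact (hfin.mem_toFinset.1 hu).2
  · intro u hu
    obtain ⟨σ, rfl⟩ := (hfin.mem_toFinset.1 hu).1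
    exact exists_le_mem_graft (s := σ.1) p (by rw [σ.2.2]; exact hk)

/-! ### Lower estimates for block sequences in a cone -/

theorem Cone.exists_le {k : ℕ} {t : List ℕ} (ht : t.length < k) {m : ℕ} {u : Om k}
    (hu : u ∈ Cone k t m) : ∃ a ∈ u.1, m ≤ a := by
  obtain ⟨v, hv, hm⟩ := hu
  have hlen := u.2.2
  rw [hv, List.length_append] at hlen
  obtain ⟨a, ha⟩ := List.exists_mem_of_length_pos (l := v) (by omega)
  exact ⟨a, by simp [hv, ha], hm a ha⟩

theorem sum_Ico_blocks {M : Type*} [AddCommMonoid M] (f : ℕ → M) {b : ℕ → ℕ} (hb : Monotone b)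
    (n : ℕ) : ∑ r ∈ Finset.Ico (b 0) (b n), f r =
      ∑ i : Fin n, ∑ r ∈ Finset.Ico (b i) (b (i + 1)), f r := by
  rw [← Finset.sum_range (fun i => ∑ r ∈ Finset.Ico (b i) (b (i + 1)), f r)]
  induction n with
  | zero => simp
  | succ n ih =>
    rw [Finset.sum_range_succ, ← ih,
      Finset.sum_Ico_consecutive _ (hb (Nat.zero_le n)) (hb n.le_succ)]

/-- The norm allows only `d` sets at a time, so `d ^ (j + 1)` blocks are split into `d` consecutive
groups of `d ^ j`; each group is captured by one set from `exists_AR_cover`, and each splitting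
costs one factor `θ`. -/
theorem pow_mul_sum_tNorm_le {k d : ℕ} {θ : ℝ} (h0 : 0 ≤ θ) (h1 : θ ≤ 1) (hd : 1 ≤ d)
    {t : List ℕ} (htk : t.length < k) (htp : t.Pairwise (· ≤ ·)) {m : ℕ → ℕ} (hm : StrictMono m)
    (ht : ∀ b ∈ t, b ≤ m 0) {w : ℕ → Om k →₀ ℝ}
    (hw : ∀ r u, w r u ≠ 0 → u ∈ Cone k t (m r) ∧ ∀ a ∈ u.1, a < m (r + 1)) (j : ℕ) :
    ∀ a, θ ^ j * ∑ r ∈ Finset.Ico a (a + d ^ j), tNorm d θ (w r) ≤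
      tNorm d θ (∑ r ∈ Finset.Ico a (a + d ^ j), w r) := by
  induction j with
  | zero => intro a; simp
  | succ j ih =>
    intro a
    set b : ℕ → ℕ := fun i => a + i * d ^ j with hbdef
    have hdj : 0 < d ^ j := pow_pos hd j
    have hb : StrictMono b := strictMono_nat_of_lt_succ fun i => by
      simp only [hbdef, Nat.succ_mul]; omega
    have hbs : ∀ i, b (i + 1) = b i + d ^ j := fun i => by
      simp only [hbdef, Nat.succ_mul]; omega
    have hb0 : b 0 = a := by simp [hbdef]
    have hbd : b d = a + d ^ (j + 1) := by simp only [hbdef]; ring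
    choose E hE hcov hlt hge using fun i : ℕ =>
      exists_AR_cover htk (p := m (b i)) (q := m (b (i + 1)))
        (fun c hc => (ht c hc).trans (hm.monotone (Nat.zero_le _))) htp (hm (hb i.lt_succ_self))
    have hadm : Admissible fun i : Fin d => E i := by
      refine ⟨fun i => hE i, fun i i' hii v hv u hu => ?_⟩
      obtain ⟨c, hc, hcm⟩ := hge i' u hu
      exact prec_of_forall_lt u.2.1 (hlt i v hv) hc
        ((hm.monotone (hb.monotone (Nat.succ_le_of_lt hii))).trans hcm)
    have hproj : ∀ i : Fin d, proj (E i) (∑ r ∈ Finset.Ico (b 0) (b d), w r) =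
        ∑ r ∈ Finset.Ico (b i) (b (i + 1)), w r := by
      intro i
      rw [proj_eq_restr, restr_sum]
      have hsub : Finset.Ico (b i) (b (i + 1)) ⊆ Finset.Ico (b 0) (b d) :=
        Finset.Ico_subset_Ico (hb.monotone (Nat.zero_le _)) (hb.monotone (Nat.succ_le_of_lt i.2))
      rw [← Finset.sum_subset hsub]
      · refine Finset.sum_congr rfl fun r hr => restr_eq_self fun u hu => ?_
        rw [Finset.mem_Ico] at hr
        obtain ⟨hu1, hu2⟩ := hw r u hu
        exact hcov i u (Cone.anti t (hm.monotone hr.1) hu1) fun c hc =>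
          (hu2 c hc).trans_le (hm.monotone hr.2)
      · intro r _ hr
        refine restr_eq_zero fun u hu huE => hr ?_
        obtain ⟨hu1, hu2⟩ := hw r u hu
        rw [Finset.mem_Ico]
        constructor
        · obtain ⟨c, hc, hcm⟩ := hge i u huE
          exact Nat.lt_succ_iff.1 (hm.lt_iff_lt.1 (hcm.trans_lt (hu2 c hc)))
        · obtain ⟨c, hc, hcm⟩ := Cone.exists_le htk hu1
          exact hm.lt_iff_lt.1 (hcm.trans_lt (hlt i u huE c hc))
    rw [← hbd, ← hb0]
    refine le_trans ?_ (mul_sum_tNorm_le h0 h1 hd le_rfl hadm _)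
    rw [sum_Ico_blocks _ hb.monotone, pow_succ', mul_assoc, Finset.mul_sum]
    refine mul_le_mul_of_nonneg_left (Finset.sum_le_sum fun i _ => ?_) h0
    rw [hproj, hbs]
    exact ih _

/-! ### Upper estimates for vectors supported by far out parts of columns -/

/-- The initial segment of length at most `n` of an element of `ω^{↓ k}`. -/
def Om.pref {k : ℕ} (u : Om k) (n : ℕ) : OmLe k :=
  ⟨u.1.take n, u.2.1.sublist (List.take_sublist _ _), by
    rw [List.length_take, u.2.2]; exact min_le_right _ _⟩

theorem ETree.length_pref_add_le {k : ℕ} (X : ETree k) (u : Om k) (j : ℕ) (hj : j ≤ k) :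
    (X.toFun (u.pref (k - j))).1.length + j ≤ k := by
  induction j with
  | zero => exact (X.toFun _).2.2
  | succ j ih =>
    have h := (X.map_init (u.pref (k - (j + 1))) (u.pref (k - j))
      ⟨List.take_prefix_take_left (by omega), by
        simp only [Om.pref, List.length_take, u.2.2]; omega⟩).2
    have := ih (by omega)
    omega

/-- Images lengthen strictly along a branch of `k + 1` nodes, while lengths are confined to `0, …,
k`; hence levels are preserved. -/
theorem ETree.length_pref {k : ℕ} (X : ETree k) (u : Om k) {n : ℕ} (hn : n ≤ k) :
    (X.toFun (u.pref n)).1.length = n := by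
  have h1 := X.length_pref_add_le u (k - n) (by omega)
  rw [Nat.sub_sub_self hn] at h1
  have h2 := X.length_le n (u.pref n) (by simp [Om.pref, u.2.2, hn])
  omega

theorem ETree.toFun_pref_eq {k : ℕ} (X : ETree k) {σ : Om k} {t : List ℕ} {m : ℕ}
    (ht : t.length < k) (h : X.restr σ ∈ Cone k t m) : (X.toFun (σ.pref t.length)).1 = t := by
  obtain ⟨v, hv, -⟩ := h
  have h1 : (X.toFun (σ.pref t.length)).1 <+: t ++ v := by
    rw [← hv]
    exact (X.map_init (σ.pref t.length) σ.toOmLe ⟨List.take_prefix _ _, by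
      simp only [Om.pref, Om.toOmLe, List.length_take, σ.2.2]; omega⟩).1
  have hl := X.length_pref σ ht.le
  exact (List.prefix_of_prefix_length_le h1 (List.prefix_append t v) hl.le).eq_of_length hl

/-- The element found is the image of the zero sequence. Meeting two columns means that two nodes of
level `s.length + 1` have different images, so one of them is not a zero sequence. It then lies
above the zero sequence of length `k`, whose image therefore lies below `s ++ [i]` or `s ++ [i']`.
-/
theorem exists_forall_lt_of_mem_AR {k : ℕ} {E : Finset (Om k)} (hE : E ∈ AR k) {s : List ℕ}
    {L i i' : ℕ} (hs : ∀ a ∈ s, a < L) (hsk : s.length + 1 < k) (hi : i < L) (hi' : i' < L)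
    (hne : i ≠ i') {u u' : Om k} (hu : u ∈ E) (hu' : u' ∈ E) (huc : u ∈ Cone k (s ++ [i]) L)
    (huc' : u' ∈ Cone k (s ++ [i']) L) : ∃ w ∈ E, ∀ a ∈ w.1, a < L := by
  obtain ⟨-, A, ⟨X, rfl⟩, n, hsub, -, hmin⟩ := hE
  have key : ∀ c < L, ∀ σ : Om k, X.restr σ ∈ Cone k (s ++ [c]) L →
      (∃ a ∈ (σ.pref (s.length + 1)).1, a ≠ 0) →
      ∀ a ∈ (X.restr ⟨List.replicate k 0, List.pairwise_replicate.2 (Or.inr le_rfl),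
        by simp⟩).1, a < L := by
    rintro c hc σ hσ ⟨a, ha, ha0⟩ b hb
    have heq := X.toFun_pref_eq (by simpa using hsk) hσ
    rw [List.length_append, List.length_singleton] at heq
    have hprec := X.map_prec (Om.toOmLe ⟨List.replicate k 0,
      List.pairwise_replicate.2 (Or.inr le_rfl), by simp⟩) (σ.pref (s.length + 1))
      (prec_of_forall_lt (q := 1) (σ.pref _).2.1 (fun b hb => by
        have : b = 0 := (List.mem_replicate.1 hb).2
        omega) ha (by omega))
    obtain ⟨e, he, hbe⟩ := exists_le_of_prec (X.toFun _).2.1 hprec hb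
    rw [heq] at he
    rcases List.mem_append.1 he with h | h
    · exact hbe.trans_lt (hs e h)
    · rw [List.mem_singleton.1 h] at hbe
      exact hbe.trans_lt hc
  obtain ⟨σ, rfl⟩ := hsub hu
  obtain ⟨σ', rfl⟩ := hsub hu'
  have hsmall : ∀ a ∈ (X.restr ⟨List.replicate k 0,
      List.pairwise_replicate.2 (Or.inr le_rfl), by simp⟩).1, a < L := by
    by_cases h1 : ∃ a ∈ (σ.pref (s.length + 1)).1, a ≠ 0
    · exact key i hi σ huc h1
    by_cases h2 : ∃ a ∈ (σ'.pref (s.length + 1)).1, a ≠ 0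
    · exact key i' hi' σ' huc' h2
    push Not at h1 h2
    exfalso
    have hrep : ∀ τ : Om k, (∀ a ∈ (τ.pref (s.length + 1)).1, a = 0) →
        (τ.pref (s.length + 1)).1 = List.replicate (s.length + 1) 0 := fun τ hτ =>
      List.eq_replicate_iff.2 ⟨by simp only [Om.pref, List.length_take, τ.2.2]; omega, hτ⟩
    have h3 : σ.pref (s.length + 1) = σ'.pref (s.length + 1) :=
      Subtype.ext ((hrep σ h1).trans (hrep σ' h2).symm)
    have e1 := X.toFun_pref_eq (by simpa using hsk) huc
    have e2 := X.toFun_pref_eq (by simpa using hsk) huc'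
    rw [List.length_append, List.length_singleton] at e1 e2
    rw [h3, e2] at e1
    simp only [List.append_cancel_left_eq, List.cons.injEq, and_true] at e1
    exact hne e1.symm
  refine ⟨_, ?_, hsmall⟩
  -- If the initial segment `E` missed this image, then `u` would lie below it; but `u` has an entry
  -- at least `L`.
  by_contra hnot
  obtain ⟨a, ha, hLa⟩ := Cone.exists_le (by simpa using hsk) huc
  obtain ⟨b, hb, hab⟩ := exists_le_of_prec (X.restr σ).2.1 (hmin _ hu _ ⟨_, rfl⟩ hnot) ha
  have := hsmall b hb
  omega

/-- In an admissible family at most one set meets two columns. All other pieces sit in one column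
and contribute at most `A`; the exceptional one is treated by induction on the level of the norm.
The constant `C = d / (1 - θ)` is chosen so that `C * (1 - θ) = d` closes this recursion. -/
theorem tNorm_le_of_columns {k d : ℕ} {θ : ℝ} (h0 : 0 ≤ θ) (h1 : θ < 1) (hd : 1 ≤ d)
    {s : List ℕ} {L : ℕ} (hs : ∀ a ∈ s, a < L) (hsk : s.length + 1 < k) {x : Om k →₀ ℝ}
    (hx : ∀ u, x u ≠ 0 → ∃ i < L, u ∈ Cone k (s ++ [i]) L) {A : ℝ}
    (hA : ∀ i < L, tNorm d θ (restr (Cone k (s ++ [i]) L) x) ≤ A) (hA0 : 0 ≤ A) :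
    tNorm d θ x ≤ d / (1 - θ) * A := by
  set C : ℝ := d / (1 - θ) with hC
  have hd1 : (1 : ℝ) ≤ d := by exact_mod_cast hd
  have hθ : 0 < 1 - θ := by linarith
  have hCeq : C * (1 - θ) = d := by rw [hC]; field_simp
  have hC1 : 1 ≤ C := by rw [hC, le_div_iff₀ hθ]; linarith
  have hAC : A ≤ C * A := le_mul_of_one_le_left hA0 hC1
  refine ciSup_le fun j => ?_
  induction j generalizing x with
  | zero =>
    refine Real.iSup_le (fun v => ?_) (hA0.trans hAC)
    by_cases hv : x v = 0
    · rw [hv, abs_zero]; exact hA0.trans hAC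
    · obtain ⟨i, hi, hvi⟩ := hx v hv
      rw [← restr_apply_mem x hvi]
      exact ((abs_apply_le_tNorm h0 h1.le _ v).trans (hA i hi)).trans hAC
  | succ j ih =>
    refine max_le (ih hx hA) ?_
    have hsum : sSup (admSums d (preNorm d θ j) x) ≤ d * A + (C - 1) * A := by
      have hCA : 0 ≤ (C - 1) * A := mul_nonneg (by linarith) hA0
      refine Real.sSup_le ?_ (by positivity)
      rintro _ ⟨m, -, hmd, E, hE, rfl⟩
      have hall : ∀ i, preNorm d θ j (proj (E i) x) ≤ C * A := by
        intro i
        rw [proj_eq_restr]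
        refine ih (fun u hu => hx u (mem_of_restr_ne_zero hu).2) fun c hc => ?_
        rw [restr_comm]
        exact (tNorm_restr_le h0 h1.le _ _).trans (hA c hc)
      let bad : Fin m → Prop := fun i => ∃ c < L, ∃ c' < L, c ≠ c' ∧ ∃ u ∈ E i, ∃ u' ∈ E i,
        u ∈ Cone k (s ++ [c]) L ∧ u' ∈ Cone k (s ++ [c']) L
      have hgood : ∀ i, ¬ bad i → preNorm d θ j (proj (E i) x) ≤ A := by
        intro i hi
        rw [proj_eq_restr]
        refine (preNorm_le_tNorm h0 h1.le j _).trans ?_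
        by_cases hex : ∃ u ∈ E i, x u ≠ 0
        · obtain ⟨u, huE, hu⟩ := hex
          obtain ⟨c, hc, huc⟩ := hx u hu
          have heq : restr (E i : Set (Om k)) x =
              restr (Cone k (s ++ [c]) L) (restr (E i : Set (Om k)) x) := by
            refine (restr_eq_self fun v hv => ?_).symm
            obtain ⟨hvE, hv⟩ := mem_of_restr_ne_zero hv
            obtain ⟨c', hc', hvc⟩ := hx v hv
            by_cases hcc : c = c'
            · rwa [hcc]
            · exact absurd ⟨c, hc, c', hc', hcc, u, huE, v, hvE, huc, hvc⟩ hi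
          rw [heq, restr_comm]
          exact (tNorm_restr_le h0 h1.le _ _).trans (hA c hc)
        · push Not at hex
          rw [restr_eq_zero fun v hv hvE => hv (hex v hvE), tNorm_zero]
          exact hA0
      -- The later set would contain an element with all entries below `L`, whereas the earlier one
      -- contains an element of a column, with an entry at least `L`.
      have huniq : ∀ i i', i < i' → bad i → ¬ bad i' := by
        rintro i i' hii ⟨c, hc, -, -, -, u, hu, -, -, huc, -⟩
          ⟨e, he, e', he', hne, v, hv, v', hv', hvc, hvc'⟩
        obtain ⟨w, hw, hwL⟩ := exists_forall_lt_of_mem_AR (hE.1 i') hs hsk he he' hne hv hv' hvc hvc'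
        obtain ⟨a, ha, hLa⟩ := Cone.exists_le (by simpa using hsk) huc
        obtain ⟨b, hb, hab⟩ := exists_le_of_prec u.2.1 (hE.2 i i' hii u hu w hw) ha
        have := hwL b hb
        omega
      have hmA : (m : ℝ) * A ≤ d * A :=
        mul_le_mul_of_nonneg_right (by exact_mod_cast hmd) hA0
      by_cases hex : ∃ i, bad i
      · obtain ⟨i₀, hi₀⟩ := hex
        -- The exceptional piece costs `C * A`, that is, `(C - 1) * A` beyond the uniform bound.
        have hle : ∀ i, preNorm d θ j (proj (E i) x) ≤ A + if i = i₀ then (C - 1) * A else 0 := by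
          intro i
          split_ifs with hii
          · have := hall i; linarith
          · rw [add_zero]
            refine hgood i fun hb => ?_
            rcases lt_or_gt_of_ne hii with h | h
            exacts [huniq _ _ h hb hi₀, huniq _ _ h hi₀ hb]
        refine (Finset.sum_le_sum fun i _ => hle i).trans ?_
        rw [Finset.sum_add_distrib, Finset.sum_ite_eq']
        simpa using hmA
      · push Not at hex
        refine (Finset.sum_le_sum fun i _ => hgood i (hex i)).trans ?_
        simp only [Finset.sum_const, Finset.card_univ, Fintype.card_fin, nsmul_eq_mul]
        linarith
    refine (mul_le_mul_of_nonneg_left hsum h0).trans ?_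
    have h2 : C * A * (1 - θ) = d * A := by rw [← hCeq]; ring
    have h3 : θ * (d * A) ≤ d * A := mul_le_of_le_one_left (by positivity) h1.le
    nlinarith [mul_nonneg h0 hA0]

/-! ### Operators that are small on far out vectors -/

section Small

variable {k d : ℕ} {θ : ℝ}

theorem tNorm_restr_mono (h0 : 0 ≤ θ) (h1 : θ ≤ 1) {A B : Set (Om k)} (hAB : A ⊆ B)
    (x : Om k →₀ ℝ) : tNorm d θ (restr A x) ≤ tNorm d θ (restr B x) := by
  rw [← Set.inter_eq_left.2 hAB, ← restr_restr]
  exact tNorm_restr_le h0 h1 _ _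

theorem tNorm_restr_union_le (h0 : 0 ≤ θ) (h1 : θ ≤ 1) (A B : Set (Om k)) (x : Om k →₀ ℝ) :
    tNorm d θ (restr (A ∪ B) x) ≤ tNorm d θ (restr A x) + tNorm d θ (restr B x) := by
  classical
  have h : restr (A ∪ B) x = restr A x + restr (B \ A) x := by
    ext v
    simp only [Finsupp.add_apply, restr_apply, Set.mem_union, Set.mem_sdiff]
    by_cases hA : v ∈ A <;> by_cases hB : v ∈ B <;> simp [hA, hB]
  rw [h]
  exact (tNorm_add d h0 h1 _ _).trans
    (add_le_add le_rfl (tNorm_restr_mono h0 h1 Set.sdiff_subset x))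

theorem tNorm_restr_biUnion_le (h0 : 0 ≤ θ) (h1 : θ ≤ 1) {ι : Type*} (F : Finset ι)
    (A : ι → Set (Om k)) (x : Om k →₀ ℝ) :
    tNorm d θ (restr {u | ∃ i ∈ F, u ∈ A i} x) ≤ ∑ i ∈ F, tNorm d θ (restr (A i) x) := by
  classical
  induction F using Finset.induction_on with
  | empty =>
    rw [restr_eq_zero (by simp), tNorm_zero]
    simp
  | insert a F ha ih =>
    rw [Finset.sum_insert ha]
    have : {u | ∃ i ∈ insert a F, u ∈ A i} = A a ∪ {u | ∃ i ∈ F, u ∈ A i} := by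
      ext u; simp
    rw [this]
    exact (tNorm_restr_union_le h0 h1 _ _ x).trans (by gcongr)

theorem exists_coord_bound (y : Om k →₀ ℝ) : ∃ b : ℕ, ∀ u, y u ≠ 0 → ∀ a ∈ u.1, a < b := by
  refine ⟨y.support.sup (fun u => u.1.sum) + 1, fun u hu a ha => Nat.lt_succ_iff.2 ?_⟩
  exact (List.le_sum_of_mem ha).trans
    (Finset.le_sup (f := fun u : Om k => u.1.sum) (Finsupp.mem_support_iff.2 hu))

end Small

/-- The union of the cones over a finite set of nodes. -/
def cones (k : ℕ) (F : Finset (List ℕ)) : Set (Om k) := {u | ∃ t ∈ F, u ∈ Cone k t 0}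

/-! ### The induction on the height of the cones -/

section Operators

variable {k₁ k₂ d : ℕ} {θ : ℝ}

/-- A cone over a node of full length is at most a point, so only finitely many coordinates have to
vanish, while the vectors supported on `Cone k₁ s M` form an infinite-dimensional space. -/
theorem exists_restr_eq_zero (h0 : 0 ≤ θ) (h1 : θ ≤ 1)
    (Φ : (Om k₁ →₀ ℝ) →ₗ[ℝ] (Om k₂ →₀ ℝ)) {F : Finset (List ℕ)} (hF : ∀ t ∈ F, t.length = k₂)
    {s : List ℕ} (hs : s.length + 1 = k₁) (hsp : s.Pairwise (· ≤ ·)) {M : ℕ}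
    (hsM : ∀ a ∈ s, a ≤ M) :
    ∃ z : Om k₁ →₀ ℝ, (∀ u, z u ≠ 0 → u ∈ Cone k₁ s M) ∧ tNorm d θ z = 1 ∧
      restr (cones k₂ F) (Φ z) = 0 := by
  have hfin : (cones k₂ F).Finite := by
    refine (F.finite_toSet.preimage (f := fun u : Om k₂ => u.1)
      Subtype.val_injective.injOn).subset ?_
    rintro u ⟨t, ht, v, hv, -⟩
    have hlen := u.2.2
    rw [hv, List.length_append, hF t ht] at hlen
    have : v = [] := List.length_eq_zero_iff.1 (by omega)
    subst this
    rw [List.append_nil] at hv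
    simpa [hv] using ht
  have : Finite (cones k₂ F) := hfin
  let pt : ℕ → Om k₁ := fun n => ⟨s ++ [M + n], by
    rw [List.pairwise_append]
    refine ⟨hsp, by simp, fun a ha b hb => ?_⟩
    rw [List.mem_singleton.1 hb]
    exact (hsM a ha).trans (Nat.le_add_right _ _), by simpa using hs⟩
  have hpt : Function.Injective pt := fun a b h => by
    have := congrArg Subtype.val h
    simpa [pt] using this
  let ψ : (ℕ →₀ ℝ) →ₗ[ℝ] (cones k₂ F → ℝ) :=
    LinearMap.pi fun u => (Finsupp.lapply u.1).comp (Φ.comp (Finsupp.lmapDomain ℝ ℝ pt))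
  obtain ⟨c, hc, hc0⟩ : ∃ c, ψ c = 0 ∧ c ≠ 0 := by
    by_contra! hcon
    have hli := (Finsupp.basisSingleOne (R := ℝ) (ι := ℕ)).linearIndependent.map' ψ
      (LinearMap.ker_eq_bot'.2 hcon)
    exact (Infinite.not_finite (α := ℕ)) hli.finite
  set x := Finsupp.mapDomain pt c with hx
  have hx0 : x ≠ 0 := fun h => hc0 (Finsupp.mapDomain_injective hpt (by simpa [hx] using h))
  have hnx : tNorm d θ x ≠ 0 := fun h => hx0 (eq_zero_of_tNorm d h0 h1 x h)
  refine ⟨(tNorm d θ x)⁻¹ • x, fun u hu => ?_, ?_, ?_⟩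
  · have hu : x u ≠ 0 := fun h => hu (by simp [h])
    have : u ∈ Set.range pt := by
      by_contra hcon
      exact hu (Finsupp.mapDomain_of_notMem_range _ _ hcon)
    obtain ⟨n, rfl⟩ := this
    exact ⟨[M + n], rfl, by simp⟩
  · rw [tNorm_smul, abs_inv, abs_of_nonneg (tNorm_nonneg d θ x), inv_mul_cancel₀ hnx]
  · refine restr_eq_zero fun v hv hvF => hv ?_
    have : Φ x v = 0 := congrFun hc ⟨v, hvF⟩
    simp [this]

/-- The finite set `F` is arbitrary because the inductive step enlarges it: nodes of `F` are
replaced by finitely many of their children. -/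
theorem exists_small (h0 : 0 < θ) (h1 : θ < 1) (hdθ : 1 < d * θ)
    (Φ : (Om k₁ →₀ ℝ) →ₗ[ℝ] (Om k₂ →₀ ℝ)) {B : ℝ} (hB0 : 0 ≤ B)
    (hB : ∀ x, tNorm d θ (Φ x) ≤ B * tNorm d θ x) (l : ℕ) :
    ∀ (F : Finset (List ℕ)), (∀ t ∈ F, t.length + l = k₂) → ∀ s : List ℕ,
      s.length + l + 1 = k₁ → s.Pairwise (· ≤ ·) → ∀ M, (∀ a ∈ s, a ≤ M) → ∀ δ : ℝ, 0 < δ →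
      ∃ z : Om k₁ →₀ ℝ, (∀ u, z u ≠ 0 → u ∈ Cone k₁ s M) ∧ tNorm d θ z = 1 ∧
        tNorm d θ (restr (cones k₂ F) (Φ z)) < δ := by
  classical
  have hd : 1 ≤ d := Nat.one_le_iff_ne_zero.2 fun h => by
    rw [h] at hdθ; norm_num at hdθ
  induction l with
  | zero =>
    intro F hF s hs hsp M hsM δ hδ
    obtain ⟨z, hz, hz1, hz0⟩ := exists_restr_eq_zero (d := d) h0.le h1.le Φ hF hs hsp hsM
    exact ⟨z, hz, hz1, by rwa [hz0, tNorm_zero]⟩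
  | succ l ih =>
    intro F hF s hs hsp M hsM δ hδ
    by_contra! hcon
    set C : ℝ := d / (1 - θ) * 1 with hC
    -- The final count gives `(dθ) ^ j * (δ / 2) ≤ F.card * (B * C + 1)`; this `j` violates it.
    obtain ⟨j, hj⟩ := pow_unbounded_of_one_lt (F.card * (B * C + 1) * 2 / δ) hdθ
    set N := d ^ j with hN
    have hNpos : 0 < N := pow_pos hd j
    have hNR : (0 : ℝ) < N := by exact_mod_cast hNpos
    -- The bound `δ / 2` leaves half of the mass in the far parts of the cones; the bound `1 / N`
    -- keeps the total of the `N` errors at most `1`.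
    set ε : ℝ := min (δ / 2) (1 / N) with hε
    have hεpos : 0 < ε := lt_min (by positivity) (by positivity)
    let G : ℕ → Finset (List ℕ) := fun n =>
      (F ×ˢ Finset.range n).image fun q => q.1 ++ [q.2]
    have hg : ∀ i n : ℕ, ∃ z : Om k₁ →₀ ℝ,
        (∀ u, z u ≠ 0 → u ∈ Cone k₁ (s ++ [M + i]) (M + N)) ∧
        (i < N → tNorm d θ z = 1 ∧ tNorm d θ (restr (cones k₂ (G n)) (Φ z)) < ε) := by
      intro i n
      by_cases hi : i < N
      · obtain ⟨z, hz, hz1, hz2⟩ := ih (G n) (fun t ht => by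
          obtain ⟨⟨t, a⟩, hta, rfl⟩ := Finset.mem_image.1 ht
          have := hF t (Finset.mem_product.1 hta).1
          simp only [List.length_append, List.length_singleton]; omega) (s ++ [M + i])
          (by simp only [List.length_append, List.length_singleton]; omega)
          (by
            rw [List.pairwise_append]
            refine ⟨hsp, by simp, fun a ha b hb => ?_⟩
            rw [List.mem_singleton.1 hb]
            exact (hsM a ha).trans (Nat.le_add_right _ _))
          (M + N) (fun a ha => by
            rcases List.mem_append.1 ha with h | h
            · exact (hsM a h).trans (Nat.le_add_right _ _)
            · rw [List.mem_singleton.1 h]; omega) ε hεpos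
        exact ⟨z, hz, fun _ => ⟨hz1, hz2⟩⟩
      -- Only indices below `N` matter; the value `0` makes the choice total.
      · exact ⟨0, by simp, fun h => absurd h hi⟩
    choose g hgs hg1 using hg
    choose bd hbd using fun y : Om k₂ →₀ ℝ => exists_coord_bound y
    -- The start bounds the entries of all nodes of `F`; each further value exceeds every entry in
    -- the support of the image just chosen, so the far parts of the images become successive
    -- blocks.
    let m : ℕ → ℕ := fun r => Nat.rec (F.sup List.sum)
      (fun r mr => max (mr + 1) (bd (Φ (g r mr)))) r
    have hmsucc : ∀ r, m (r + 1) = max (m r + 1) (bd (Φ (g r (m r)))) := fun r => rfl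
    have hm : StrictMono m := strictMono_nat_of_lt_succ fun r => by
      rw [hmsucc]; exact lt_max_of_lt_left (Nat.lt_succ_self _)
    have hm0 : ∀ t ∈ F, ∀ b ∈ t, b ≤ m 0 := fun t ht b hb =>
      (List.le_sum_of_mem hb).trans (Finset.le_sup (f := List.sum) ht)
    set z : ℕ → Om k₁ →₀ ℝ := fun r => g r (m r) with hz
    set w : List ℕ → ℕ → Om k₂ →₀ ℝ := fun t r => restr (Cone k₂ t (m r)) (Φ (z r)) with hw
    have htk : ∀ t ∈ F, t.length < k₂ := fun t ht => by have := hF t ht; omega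
    have hlower : ∀ t ∈ F, θ ^ j * ∑ r ∈ Finset.range N, tNorm d θ (w t r) ≤
        tNorm d θ (∑ r ∈ Finset.range N, w t r) := by
      intro t ht
      by_cases htp : t.Pairwise (· ≤ ·)
      · have := pow_mul_sum_tNorm_le h0.le h1.le hd (htk t ht) htp hm (hm0 t ht) (w := w t)
          (fun r u hu => by
            obtain ⟨hu1, hu2⟩ := mem_of_restr_ne_zero hu
            refine ⟨hu1, fun a ha => ?_⟩
            rw [hmsucc]
            exact lt_max_of_lt_right (hbd _ u hu2 a ha)) j 0
        rw [Finset.range_eq_Ico]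
        rwa [zero_add] at this
      -- A node that is not non-decreasing has an empty cone.
      · have hw0 : ∀ r, w t r = 0 := fun r => restr_eq_zero fun u _ hu => htp (by
          obtain ⟨v, hv, -⟩ := hu
          have := u.2.1
          rw [hv] at this
          exact (List.pairwise_append.1 this).1)
        simp [hw0, tNorm_zero]
    have hcover : ∀ t ∈ F, ∀ n, Cone k₂ t 0 \ Cone k₂ t n ⊆ cones k₂ (G n) := by
      rintro t ht n u ⟨hu, hun⟩
      obtain ⟨i, hi, hui⟩ := (Cone.mem_or (htk t ht) hu n).resolve_left hun
      exact ⟨t ++ [i], Finset.mem_image.2 ⟨(t, i), by simp [ht, hi], rfl⟩, hui⟩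
    have hbig : ∀ r < N, δ / 2 ≤ ∑ t ∈ F, tNorm d θ (w t r) := by
      intro r hr
      have hδr := hcon (z r) (fun u hu => Cone.append_subset s (Nat.le_add_right _ _)
        (Nat.le_add_right _ _) (hgs r (m r) u hu)) (hg1 r (m r) hr).1
      have hsub : cones k₂ F ⊆ cones k₂ (G (m r)) ∪ {u | ∃ t ∈ F, u ∈ Cone k₂ t (m r)} := by
        rintro u ⟨t, ht, hu⟩
        by_cases hun : u ∈ Cone k₂ t (m r)
        · exact Or.inr ⟨t, ht, hun⟩
        · exact Or.inl (hcover t ht (m r) ⟨hu, hun⟩)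
      have h2 := (tNorm_restr_mono (d := d) h0.le h1.le hsub (Φ (z r))).trans
        (tNorm_restr_union_le h0.le h1.le _ _ _)
      have h3 := tNorm_restr_biUnion_le (d := d) h0.le h1.le F (fun t => Cone k₂ t (m r)) (Φ (z r))
      have h4 := (hg1 r (m r) hr).2
      have h5 : ε ≤ δ / 2 := min_le_left _ _
      simp only [hw]
      simp only [hz] at *
      linarith
    have hupper : ∀ t ∈ F, tNorm d θ (∑ r ∈ Finset.range N, w t r) ≤
        tNorm d θ (Φ (∑ r ∈ Finset.range N, z r)) + 1 := by
      intro t ht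
      have heq : restr (Cone k₂ t 0) (Φ (∑ r ∈ Finset.range N, z r)) =
          ∑ r ∈ Finset.range N, w t r +
            ∑ r ∈ Finset.range N, restr (Cone k₂ t 0 \ Cone k₂ t (m r)) (Φ (z r)) := by
        rw [map_sum, restr_sum, ← Finset.sum_add_distrib]
        refine Finset.sum_congr rfl fun r _ => ?_
        ext u
        have := @Cone.anti k₂ t 0 (m r) (Nat.zero_le _) u
        simp only [hw, Finsupp.add_apply, restr_apply, Set.mem_sdiff]
        by_cases h1 : u ∈ Cone k₂ t 0 <;> by_cases h2 : u ∈ Cone k₂ t (m r) <;> simp_all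
      have herr : tNorm d θ (∑ r ∈ Finset.range N,
          restr (Cone k₂ t 0 \ Cone k₂ t (m r)) (Φ (z r))) ≤ 1 := by
        refine (tNorm_sum_le h0.le h1.le _ _).trans ?_
        calc _ ≤ ∑ r ∈ Finset.range N, (1 / N : ℝ) := by
              refine Finset.sum_le_sum fun r hr => ?_
              exact ((tNorm_restr_mono h0.le h1.le (hcover t ht (m r)) _).trans
                (hg1 r (m r) (Finset.mem_range.1 hr)).2.le).trans (min_le_right _ _)
          _ = 1 := by
              rw [Finset.sum_const, Finset.card_range, nsmul_eq_mul]
              field_simp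
      have h2 : ∑ r ∈ Finset.range N, w t r =
          restr (Cone k₂ t 0) (Φ (∑ r ∈ Finset.range N, z r)) + (-1 : ℝ) •
            ∑ r ∈ Finset.range N, restr (Cone k₂ t 0 \ Cone k₂ t (m r)) (Φ (z r)) := by
        rw [heq]; simp
      rw [h2]
      refine (tNorm_add d h0.le h1.le _ _).trans (add_le_add (tNorm_restr_le h0.le h1.le _ _) ?_)
      rw [tNorm_smul]
      simpa using herr
    have hzC : tNorm d θ (∑ r ∈ Finset.range N, z r) ≤ C := by
      refine tNorm_le_of_columns (L := M + N) h0.le h1 hd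
        (fun a ha => (hsM a ha).trans_lt (by omega)) (by omega) ?_ ?_ zero_le_one
      · intro u hu
        rw [Finsupp.finsetSum_apply] at hu
        obtain ⟨r, hr, hru⟩ := Finset.exists_ne_zero_of_sum_ne_zero hu
        exact ⟨M + r, by have := Finset.mem_range.1 hr; omega, hgs r (m r) u hru⟩
      · intro i _
        rw [restr_sum]
        have hoff : ∀ r, M + r ≠ i → restr (Cone k₁ (s ++ [i]) (M + N)) (z r) = 0 := by
          intro r hr
          refine restr_eq_zero fun u hu hui => hr ?_
          have := Cone.eq_of_mem (by simp) (hgs r (m r) u hu) hui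
          simpa using this
        by_cases hex : ∃ r < N, M + r = i
        · obtain ⟨r, hr, hri⟩ := hex
          rw [Finset.sum_eq_single r (fun r' _ hne => hoff r' (by omega))
            (fun h => absurd (Finset.mem_range.2 hr) h)]
          exact (tNorm_restr_le h0.le h1.le _ _).trans (hg1 r (m r) hr).1.le
        · push Not at hex
          rw [Finset.sum_eq_zero fun r hr => hoff r (hex r (Finset.mem_range.1 hr)), tNorm_zero]
          exact zero_le_one
    have hΦ : tNorm d θ (Φ (∑ r ∈ Finset.range N, z r)) ≤ B * C :=
      (hB _).trans (mul_le_mul_of_nonneg_left hzC hB0)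
    have hfinal : θ ^ j * (N * (δ / 2)) ≤ F.card * (B * C + 1) := by
      calc θ ^ j * (N * (δ / 2)) = θ ^ j * ∑ r ∈ Finset.range N, δ / 2 := by simp
        _ ≤ θ ^ j * ∑ r ∈ Finset.range N, ∑ t ∈ F, tNorm d θ (w t r) := by
            refine mul_le_mul_of_nonneg_left (Finset.sum_le_sum fun r hr => ?_) (by positivity)
            exact hbig r (Finset.mem_range.1 hr)
        _ = ∑ t ∈ F, θ ^ j * ∑ r ∈ Finset.range N, tNorm d θ (w t r) := by
            rw [Finset.sum_comm, Finset.mul_sum]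
        _ ≤ ∑ t ∈ F, (B * C + 1) := Finset.sum_le_sum fun t ht =>
            ((hlower t ht).trans (hupper t ht)).trans (by linarith)
        _ = F.card * (B * C + 1) := by rw [Finset.sum_const, nsmul_eq_mul]
    rw [div_lt_iff₀ hδ, mul_pow] at hj
    have hNd : (N : ℝ) = (d : ℝ) ^ j := by rw [hN]; push_cast; rfl
    rw [hNd] at hfinal
    linarith

theorem not_bounded_below (h0 : 0 < θ) (h1 : θ < 1) (hdθ : 1 < d * θ) (hk : k₂ < k₁)
    (Φ : (Om k₁ →₀ ℝ) →ₗ[ℝ] (Om k₂ →₀ ℝ)) {B c : ℝ} (hB0 : 0 ≤ B)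
    (hB : ∀ x, tNorm d θ (Φ x) ≤ B * tNorm d θ x) (hc : 0 < c) :
    ¬ ∀ x, c * tNorm d θ x ≤ tNorm d θ (Φ x) := by
  intro h
  obtain ⟨z, -, hz1, hz⟩ := exists_small h0 h1 hdθ Φ hB0 hB k₂ {[]} (by simp)
    (List.replicate (k₁ - k₂ - 1) 0) (by rw [List.length_replicate]; omega)
    (List.pairwise_replicate.2 (Or.inr le_rfl)) 0
    (fun a ha => (List.mem_replicate.1 ha).2.le) c hc
  have huniv : ∀ v : Om k₂, v ∈ cones k₂ {[]} := fun v => ⟨[], by simp, v.1, rfl, by simp⟩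
  rw [restr_eq_self fun v _ => huniv v] at hz
  have := h z
  rw [hz1, mul_one] at this
  exact absurd hz this.not_gt

end Operators

/-! ### Reduction to finitely supported vectors -/

instance (k : ℕ) : Countable (Om k) := Subtype.val_injective.countable

open UniformSpace in
/-- A bounded operator that is bounded below can be perturbed so that it maps finitely supported
vectors to finitely supported ones. -/
theorem Embeds.exists_linearMap {k₁ k₂ d : ℕ} {θ : Set.Ioo (0 : ℝ) 1}
    (h : Embeds (TSpace k₁ d θ) (TSpace k₂ d θ)) :
    ∃ Ψ : (Om k₁ →₀ ℝ) →ₗ[ℝ] (Om k₂ →₀ ℝ), ∃ B c : ℝ, 0 ≤ B ∧ 0 < c ∧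
      (∀ x, tNorm d θ.1 (Ψ x) ≤ B * tNorm d θ.1 x) ∧
      ∀ x, c * tNorm d θ.1 x ≤ tNorm d θ.1 (Ψ x) := by
  obtain ⟨Φ, c, hc, hΦ⟩ := h
  let J₁ : C00 k₁ d θ →ₗᵢ[ℝ] TSpace k₁ d θ := Completion.toComplₗᵢ
  let J₂ : C00 k₂ d θ →ₗᵢ[ℝ] TSpace k₂ d θ := Completion.toComplₗᵢ
  let T : (Om k₁ →₀ ℝ) →ₗ[ℝ] TSpace k₂ d θ := Φ.toLinearMap.comp J₁.toLinearMap
  let S : (Om k₂ →₀ ℝ) →ₗ[ℝ] TSpace k₂ d θ := J₂.toLinearMap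
  have hS : ∀ y, ‖S y‖ = tNorm d θ.1 y := fun y => J₂.norm_map y
  have hJ : ∀ x : Om k₁ →₀ ℝ, ‖J₁ x‖ = tNorm d θ.1 x := fun x => J₁.norm_map x
  have hTl : ∀ x, c * tNorm d θ.1 x ≤ ‖T x‖ := fun x => by
    rw [← hJ]; exact hΦ (J₁ x)
  have hTu : ∀ x, ‖T x‖ ≤ ‖Φ‖ * tNorm d θ.1 x := fun x => by
    rw [← hJ]; exact Φ.le_opNorm (J₁ x)
  have := Encodable.ofCountable (Om k₁)
  -- Coordinates are bounded by the norm, so moving the images of the unit vectors by a total of at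
  -- most `c / 2` changes the operator by at most `c / 2` in norm and leaves the lower bound `c /
  -- 2`.
  obtain ⟨ε, hε, e, hsum, hec⟩ := posSumOfEncodable (half_pos hc) (Om k₁)
  have happrox : ∀ u, ∃ y : Om k₂ →₀ ℝ, ‖T (Finsupp.single u 1) - S y‖ ≤ ε u := by
    intro u
    obtain ⟨y, hy⟩ := Completion.denseRange_coe.exists_dist_lt (T (Finsupp.single u 1)) (hε u)
    exact ⟨y, by rw [dist_eq_norm] at hy; exact hy.le⟩
  choose y hy using happrox
  let Ψ : (Om k₁ →₀ ℝ) →ₗ[ℝ] (Om k₂ →₀ ℝ) := Finsupp.linearCombination ℝ y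
  have hD : ∀ x, T x - S (Ψ x) = ∑ u ∈ x.support, x u • (T (Finsupp.single u 1) - S (y u)) := by
    intro x
    have heq : T - S.comp Ψ =
        Finsupp.linearCombination ℝ fun u => T (Finsupp.single u 1) - S (y u) :=
      Finsupp.lhom_ext fun u b => by
        have : (Finsupp.single u b : Om k₁ →₀ ℝ) = b • Finsupp.single u 1 := by simp
        rw [this, map_smul, map_smul]
        simp [Ψ]
    exact LinearMap.congr_fun heq x
  have hdiff : ∀ x, ‖T x - S (Ψ x)‖ ≤ c / 2 * tNorm d θ.1 x := by
    intro x
    rw [hD]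
    calc _ ≤ ∑ u ∈ x.support, tNorm d θ.1 x * ε u := by
          refine norm_sum_le_of_le _ fun u _ => ?_
          rw [norm_smul]
          exact mul_le_mul (abs_apply_le_tNorm θ.2.1.le θ.2.2.le x u) (hy u) (norm_nonneg _)
            (tNorm_nonneg d θ.1 x)
      _ = tNorm d θ.1 x * ∑ u ∈ x.support, ε u := by rw [Finset.mul_sum]
      _ ≤ tNorm d θ.1 x * (c / 2) := by
          refine mul_le_mul_of_nonneg_left ?_ (tNorm_nonneg d θ.1 x)
          exact (sum_le_hasSum _ (fun u _ => (hε u).le) hsum).trans hec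
      _ = c / 2 * tNorm d θ.1 x := mul_comm _ _
  refine ⟨Ψ, ‖Φ‖ + c / 2, c / 2, by positivity, by positivity, fun x => ?_, fun x => ?_⟩
  · rw [← hS]
    have h1 := norm_sub_norm_le (S (Ψ x)) (T x)
    rw [norm_sub_rev] at h1
    linarith [hdiff x, hTu x]
  · rw [← hS]
    have h1 := norm_sub_norm_le (T x) (S (Ψ x))
    linarith [hdiff x, hTl x]

theorem not_embeds {k₁ k₂ d : ℕ} {θ : Set.Ioo (0 : ℝ) 1} (hdθ : 1 < (d : ℝ) * θ) (hk : k₂ < k₁) :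
    ¬ Embeds (TSpace k₁ d θ) (TSpace k₂ d θ) := by
  intro h
  obtain ⟨Ψ, B, c, hB0, hc, hB, hcΨ⟩ := h.exists_linearMap
  exact not_bounded_below θ.2.1 θ.2.2 hdθ hk Ψ hB0 hB hc hcΨ

theorem embeds_of_equiv {X Y : Type*} [NormedAddCommGroup X] [NormedSpace ℝ X]
    [NormedAddCommGroup Y] [NormedSpace ℝ Y] (e : X ≃L[ℝ] Y) : Embeds X Y := by
  refine ⟨e.toContinuousLinearMap, (‖e.symm.toContinuousLinearMap‖ + 1)⁻¹, by positivity,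
    fun x => ?_⟩
  rw [inv_mul_le_iff₀ (by positivity)]
  have := e.symm.toContinuousLinearMap.le_opNorm (e x)
  simp only [ContinuousLinearEquiv.coe_coe, ContinuousLinearEquiv.symm_apply_apply] at this
  refine this.trans ?_
  simp only [ContinuousLinearEquiv.coe_coe]
  gcongr
  linarith

end Ellentuck

end

theorem mainTheorem4 (d : ℕ) (θ : Set.Ioo (0 : ℝ) 1) (hdθ : 1 < (d : ℝ) * (θ : ℝ)) :
    (∀ k₁ k₂ : ℕ, 1 ≤ k₁ → 1 ≤ k₂ → k₁ ≠ k₂ →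
      IsEmpty (Ellentuck.TSpace k₁ d θ ≃L[ℝ] Ellentuck.TSpace k₂ d θ)) ∧
    (∀ k₁ k₂ : ℕ, 1 ≤ k₂ → k₂ < k₁ →
      ¬ Ellentuck.Embeds (Ellentuck.TSpace k₁ d θ) (Ellentuck.TSpace k₂ d θ)) := by
  refine ⟨fun k₁ k₂ _ _ hne => ⟨fun e => ?_⟩, fun k₁ k₂ _ hk => Ellentuck.not_embeds hdθ hk⟩
  rcases lt_or_gt_of_ne hne with h | h
  · exact Ellentuck.not_embeds hdθ h (Ellentuck.embeds_of_equiv e.symm)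
  · exact Ellentuck.not_embeds hdθ h (Ellentuck.embeds_of_equiv e)
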